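/- Let $n\ge 0$, $N=\{1,\dots,n\}$, and let $S_n$ be the group of permutations of $N$ (with $(st)(i)=s(t(i))$), acting on $\mathbb R^n$ on the left by $s\cdot(x_i)_i=(x_{s^{-1}(i)})_i$. For $\Omega\subseteq N$ regard $\mathrm{Sym}(\Omega)$ as the subgroup of $S_n$ of permutations fixing every point outside $\Omega$, and for $A,B\subseteq S_n$ put $AB=\{ab\mid a\in A,\ b\in B\}$. *Chambers.* For $s\in S_n$ let $\rho(s)=(s^{-1}(1),\dots,s^{-1}(n))\in\mathbb R^n$, and let $[\rho(s)]$ be the connected component containing $\rho(s)$ of the set of points of $\mathbb R^n$ whose entries are pairwise distinct. *Bases and partitions.* Let $G\le S_n$ and let $B=(b_1,\dots,b_k)$ be an orbit-minimal base for $G$. That is, with $G_0=G$, $G_i=\{g\in G_{i-1}\mid g(b_i)=b_i\}$, and $\Delta_i$ the orbit of $b_i$ under $G_{i-1}$, we have $G_k=\{1\}$ and $b_i=\min\Delta_i$ for $1\le i\le k$. Let $\Pi_0=\{N\}$; for $1\le i\le k$ let $\Gamma_i$ be the part of $\Pi_{i-1}$ containing $b_i$, and let $\Pi_i$ be obtained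 from $\Pi_{i-1}$ by replacing $\Gamma_i$ by the non-empty sets among $\{b_i\}$, $\Delta_i\setminus\{b_i\}$, $\Gamma_i\setminus\Delta_i$. Suppose that $N$ is indexed so that, for $0\le i\le k$, every part of $\Pi_i$ is a set of consecutive integers. *The set $R$.* Let $\widetilde U_i$ be the set of all products of transpositions $(d_1\;e_1)(d_2\;e_2)\cdots(d_l\;e_l)$ with $l\ge 0$, $d_1<\dots<d_l$ in $\Delta_i$ and $e_1<\dots<e_l$ in $\Gamma_i\setminus\Delta_i$. Let $U_i$ be the set of all products $g\tilde u$ with $\tilde u\in\widetilde U_i$ and $g\in\mathrm{Sym}(\Delta_i)\times\mathrm{Sym}(\Gamma_i\setminus\Delta_i)$ such that the entries of $\rho(g\tilde u)$ indexed by $\Delta_i$ are increasing and the entries indexed by $\Gamma_i\setminus\Delta_i$ are increasing. Let $H_k=\prod_{\Gamma\in\Pi_k}\mathrm{Sym}(\Gamma)$ and $$R=H_kU_kU_{k-1}\cdots U_1 .$$ Then $R$ is a right transversal for $G$ in $S_n$ (every element of $S_n$ is uniquely of the form $gr$ with $g\in G$, $r\in R$), and $$\mathcal F=\operatorname{int}\Bigl(\bigcup_{r\in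 R}\overline{[\rho(r)]}\Bigr)$$ is a fundamental domain for $G$ acting on $\mathbb R^n$. That is: $\mathcal F$ is open and connected (and non-empty); every $G$-orbit meets $\overline{\mathcal F}$; a $G$-orbit that meets $\mathcal F$ meets $\overline{\mathcal F}$ in exactly one point; and $g\mathcal F\cap\mathcal F=\emptyset$ for every $g\in G$ with $g\ne1$. -/

import Mathlib

namespace PermFund

open scoped Pointwise

/-- `F` is a fundamental domain for the action of `G` on the topological space `X`:
it is open and connected, every orbit meets its closure, an orbit meeting `F` meets the closure of
`F` in a single point, and the translates of `F` by non-trivial elements are disjoint from `F`. -/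
structure IsFundamentalDomain (G : Type*) {X : Type*} [Group G] [TopologicalSpace X]
    [MulAction G X] (F : Set X) : Prop where
  isOpen : IsOpen F
  isConnected : IsConnected F
  exists_smul_mem_closure : ∀ x : X, ∃ g : G, g • x ∈ closure F
  eq_of_smul_mem_closure : ∀ x ∈ F, ∀ g : G, g • x ∈ closure F → g • x = x
  disjoint_translate : ∀ g : G, g ≠ 1 → Disjoint (g • F) F

/-- The left action of `Sₙ` on `ℝⁿ` by permuting coordinates, `(s • x) i = x (s⁻¹ i)`. -/
instance permAction (n : ℕ) : MulAction (Equiv.Perm (Fin n)) (Fin n → ℝ) where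
  smul s x := fun i => x (s⁻¹ i)
  one_smul _ := rfl
  mul_smul s t x := by
    funext i
    change x ((s * t)⁻¹ i) = x (t⁻¹ (s⁻¹ i))
    rw [mul_inv_rev, Equiv.Perm.mul_apply]

/-- The points of `ℝⁿ` with pairwise distinct entries. -/
def distinctPoints (n : ℕ) : Set (Fin n → ℝ) := {x | Function.Injective x}

/-- The chamber of `c`: the connected component of `c` among the points with distinct entries. -/
def chamber {n : ℕ} (c : Fin n → ℝ) : Set (Fin n → ℝ) :=
  connectedComponentIn (distinctPoints n) c

/-- `ρ(s) = (s⁻¹(1), …, s⁻¹(n))`; the point `j : Fin n` stands for the integer `j + 1`. -/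
def rho {n : ℕ} (s : Equiv.Perm (Fin n)) : Fin n → ℝ := fun i => ((s⁻¹ i : Fin n) : ℝ) + 1

/-- `Sym(Ω)` as a subgroup of `Sₙ`: the permutations fixing every point outside `Ω`. -/
def symOn {n : ℕ} (Ω : Set (Fin n)) : Subgroup (Equiv.Perm (Fin n)) :=
  fixingSubgroup (Equiv.Perm (Fin n)) Ωᶜ

/-- The products `(d₁ e₁)(d₂ e₂)⋯(dₗ eₗ)` of transpositions with `d₁ < ⋯ < dₗ` in `Δ` and
`e₁ < ⋯ < eₗ` in `Γ ∖ Δ`, for all `l ≥ 0`. -/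
def swapProducts {n : ℕ} (Δ Γ : Set (Fin n)) : Set (Equiv.Perm (Fin n)) :=
  {u | ∃ (l : ℕ) (d e : Fin l → Fin n), StrictMono d ∧ StrictMono e ∧
    (∀ t, d t ∈ Δ) ∧ (∀ t, e t ∈ Γ \ Δ) ∧
    u = (List.ofFn fun t => Equiv.swap (d t) (e t)).prod}

/-- The elements `g * ũ`, with `ũ` a product of transpositions as above, and `g` in
`Sym(Δ) × Sym(Γ ∖ Δ)` such that the entries of `ρ(g * ũ)` indexed by `Δ` are increasing, and so
are those indexed by `Γ ∖ Δ`. -/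
def modifiedTransversal {n : ℕ} (Δ Γ : Set (Fin n)) : Set (Equiv.Perm (Fin n)) :=
  {u | ∃ v ∈ swapProducts Δ Γ,
    ∃ g ∈ (symOn Δ : Set (Equiv.Perm (Fin n))) * (symOn (Γ \ Δ) : Set (Equiv.Perm (Fin n))),
      u = g * v ∧ StrictMonoOn (rho u) Δ ∧ StrictMonoOn (rho u) (Γ \ Δ)}

/- Indexing: a tuple `(b₁, …, b_k)` is a function `b : Fin k → Fin n`, so `b i` is the entry
number `i + 1`. Subgroups `stabChain G b i` and partitions `parts G b i` carry the usual
indices `0, …, k`, while `delta`, `gamma` and `U` at `i : Fin k` are the objects number `i + 1`. -/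

/-- `G_i`, the subgroup of `G` fixing the first `i` entries of `b`. -/
def stabChain {n k : ℕ} (G : Subgroup (Equiv.Perm (Fin n))) (b : Fin k → Fin n) (i : ℕ) :
    Subgroup (Equiv.Perm (Fin n)) :=
  G ⊓ ⨅ j : Fin k, ⨅ _ : (j : ℕ) < i, MulAction.stabilizer (Equiv.Perm (Fin n)) (b j)

/-- The orbit of an entry of `b` under the pointwise stabilizer in `G` of the entries before it. -/
def delta {n k : ℕ} (G : Subgroup (Equiv.Perm (Fin n))) (b : Fin k → Fin n) (i : Fin k) :
    Set (Fin n) :=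
  MulAction.orbit (stabChain G b i) (b i)

/-- The part containing `x` of a partition `P`. -/
def partOf {n : ℕ} (P : Set (Set (Fin n))) (x : Fin n) : Set (Fin n) := ⋃₀ {A ∈ P | x ∈ A}

/-- The partitions `Π_i`: `Π_0 = {N}`, and each step replaces the part `Γ` containing the next
entry `b` by those of `{b}`, `Δ ∖ {b}`, `Γ ∖ Δ` that are non-empty. -/
def parts {n k : ℕ} (G : Subgroup (Equiv.Perm (Fin n))) (b : Fin k → Fin n) :
    ℕ → Set (Set (Fin n))
  | 0 => {Set.univ}
  | i + 1 =>
    if h : i < k then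
      (parts G b i \ {partOf (parts G b i) (b ⟨i, h⟩)}) ∪
        ({{b ⟨i, h⟩}, delta G b ⟨i, h⟩ \ {b ⟨i, h⟩},
          partOf (parts G b i) (b ⟨i, h⟩) \ delta G b ⟨i, h⟩} \ {∅})
    else parts G b i

/-- The part, in the partition before step `i`, of the entry `b i`. -/
def gamma {n k : ℕ} (G : Subgroup (Equiv.Perm (Fin n))) (b : Fin k → Fin n) (i : Fin k) :
    Set (Fin n) :=
  partOf (parts G b i) (b i)

/-- `b` is a base for `G`: only the identity of `G` fixes all entries of `b`; and it is orbit
minimal: each entry is the least element of its orbit under the stabilizer of the earlier ones. -/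
def IsOrbitMinimalBase {n k : ℕ} (G : Subgroup (Equiv.Perm (Fin n))) (b : Fin k → Fin n) : Prop :=
  stabChain G b k = ⊥ ∧ ∀ i : Fin k, ∀ j ∈ delta G b i, b i ≤ j

/-- The product of the groups `Sym(A)`, for `A` a part of the partition `P`: the permutations
mapping each part to itself. -/
def youngSet {n : ℕ} (P : Set (Set (Fin n))) : Set (Equiv.Perm (Fin n)) :=
  {s | ∀ A ∈ P, s '' A = A}

/-- The right transversals `U_1, …, U_k` that go into the construction. -/
def U {n k : ℕ} (G : Subgroup (Equiv.Perm (Fin n))) (b : Fin k → Fin n) (i : Fin k) :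
    Set (Equiv.Perm (Fin n)) :=
  modifiedTransversal (delta G b i) (gamma G b i)

/-- `R = H_k U_k U_{k-1} ⋯ U_1`, a product of subsets of `Sₙ`. -/
def dixonTransversal {n k : ℕ} (G : Subgroup (Equiv.Perm (Fin n))) (b : Fin k → Fin n) :
    Set (Equiv.Perm (Fin n)) :=
  youngSet (parts G b k) * (List.ofFn (U G b)).reverse.prod

end PermFund

namespace PermFund

open scoped Pointwise

/-! ### Chambers -/

/-! The chamber of `rho s` is the open cone of points sorted by `s`, and `g` carries the cone of `s`
to that of `g * s`. So the interior of the union of the closed cones of `R` is a fundamental domain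
as soon as `R` is a right transversal containing 1 and any `r ∈ R` is joined to 1 by a gallery in
`R`, each step crossing a wall by right multiplication by an adjacent transposition
(`isFundamentalDomain_chamberDomain`).

Transversal: let Y_i be the Young subgroup of Π_i. It contains G_i, and a permutation in Y_i lies in
Y_{i+1} exactly when it preserves Δ_{i+1} and fixes b_{i+1}. The elements of U_{i+1} represent the
cosets in Y_i of the stabilizer of Δ_{i+1}. As G_i is transitive on Δ_{i+1}, that stabilizer is G_i
Y_{i+1}, and G_i ∩ Y_{i+1} = G_{i+1}. Hence a transversal of G_{i+1} in Y_{i+1} times U_{i+1} is one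
of G_i in Y_i (`tailTransversal_transversal`).

Galleries: H_k and every U_i stay closed when a descent is removed by an adjacent swap; this is
where parts being intervals enters. Removing descents strips the factors of a product one at a time,
from the right (`tailTransversal_gallery`). -/

/-- The points whose entries increase along `s 0, s 1, …`. -/
def sortedBy {n : ℕ} (s : Equiv.Perm (Fin n)) : Set (Fin n → ℝ) := {x | StrictMono (x ∘ s)}

lemma rho_apply_perm {n : ℕ} (s : Equiv.Perm (Fin n)) (i : Fin n) :
    rho s (s i) = (i : ℝ) + 1 := by simp [rho]

lemma rho_lt_rho_iff {n : ℕ} (s : Equiv.Perm (Fin n)) (i j : Fin n) :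
    rho s i < rho s j ↔ s⁻¹ i < s⁻¹ j := by
  simp [rho]

lemma rho_mem_sortedBy {n : ℕ} (s : Equiv.Perm (Fin n)) : rho s ∈ sortedBy s := by
  intro i j h
  simpa [rho_apply_perm] using h

lemma sortedBy_subset_distinctPoints {n : ℕ} (s : Equiv.Perm (Fin n)) :
    sortedBy s ⊆ distinctPoints n := fun x hx => by
  have h : Function.Injective (x ∘ s) := StrictMono.injective hx
  exact (Function.Injective.of_comp_iff' x s.bijective).1 h

lemma convex_sortedBy {n : ℕ} (s : Equiv.Perm (Fin n)) : Convex ℝ (sortedBy s) := by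
  intro x hx y hy a b ha hb hab i j hij
  have h1 : x (s i) < x (s j) := hx hij
  have h2 : y (s i) < y (s j) := hy hij
  simp only [Function.comp_apply, Pi.add_apply, Pi.smul_apply, smul_eq_mul]
  rcases ha.eq_or_lt with rfl | ha
  · obtain rfl : b = 1 := by linarith
    simpa using h2
  · nlinarith [mul_lt_mul_of_pos_left h1 ha, mul_le_mul_of_nonneg_left h2.le hb]

/-- On a connected set of points with distinct entries, a difference of two coordinates never
vanishes and so keeps its sign; conversely the cone is convex. -/
lemma chamber_rho {n : ℕ} (s : Equiv.Perm (Fin n)) : chamber (rho s) = sortedBy s := by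
  apply Set.Subset.antisymm
  · intro x hx i j hij
    have hpre : IsPreconnected (chamber (rho s)) := isPreconnected_connectedComponentIn
    have hmem : rho s ∈ chamber (rho s) :=
      mem_connectedComponentIn (sortedBy_subset_distinctPoints s (rho_mem_sortedBy s))
    by_contra hlt
    have hlt : x (s j) - x (s i) ≤ 0 := by simpa using hlt
    have hpos : 0 ≤ rho s (s j) - rho s (s i) := by
      simpa using (rho_mem_sortedBy s hij).le
    have hc : ContinuousOn (fun y : Fin n → ℝ => y (s j) - y (s i)) (chamber (rho s)) := by
      fun_prop
    obtain ⟨y, hy, hy0⟩ := hpre.intermediate_value hx hmem hc ⟨hlt, hpos⟩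
    have hinj : Function.Injective y := connectedComponentIn_subset _ _ hy
    exact hij.ne' (s.injective (hinj (sub_eq_zero.1 hy0)))
  · exact (convex_sortedBy s).isPreconnected.subset_connectedComponentIn (rho_mem_sortedBy s)
      (sortedBy_subset_distinctPoints s)

lemma isOpen_sortedBy {n : ℕ} (s : Equiv.Perm (Fin n)) : IsOpen (sortedBy s) := by
  have : sortedBy s = ⋂ i, ⋂ j, ⋂ _ : i < j, {x : Fin n → ℝ | x (s i) < x (s j)} := by
    ext x
    simp [sortedBy, StrictMono]
  rw [this]
  exact isOpen_iInter_of_finite fun i => isOpen_iInter_of_finite fun j =>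
    isOpen_iInter_of_finite fun _ => isOpen_lt (continuous_apply _) (continuous_apply _)

lemma mem_closure_sortedBy_iff {n : ℕ} (s : Equiv.Perm (Fin n)) (x : Fin n → ℝ) :
    x ∈ closure (sortedBy s) ↔ Monotone (x ∘ s) := by
  constructor
  · have hcl : IsClosed {x : Fin n → ℝ | Monotone (x ∘ s)} := by
      have : {x : Fin n → ℝ | Monotone (x ∘ s)} =
          ⋂ i, ⋂ j, ⋂ _ : i ≤ j, {x : Fin n → ℝ | x (s i) ≤ x (s j)} := by
        ext x
        simp [Monotone]
      rw [this]
      exact isClosed_iInter fun i => isClosed_iInter fun j => isClosed_iInter fun _ =>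
        isClosed_le (continuous_apply _) (continuous_apply _)
    exact fun hx => closure_minimal (fun y hy => StrictMono.monotone hy) hcl hx
  · intro hx
    -- Adding a small positive multiple of `rho s` breaks the ties of `x` in the order prescribed by
    -- `s`.
    have hc : Continuous fun ε : ℝ => x + ε • rho s := by fun_prop
    have ht : Filter.Tendsto (fun ε : ℝ => x + ε • rho s) (nhdsWithin 0 (Set.Ioi 0)) (nhds x) := by
      simpa using (hc.tendsto 0).mono_left nhdsWithin_le_nhds
    refine mem_closure_of_tendsto ht ?_
    filter_upwards [self_mem_nhdsWithin] with ε hε i j hij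
    have h1 : x (s i) ≤ x (s j) := hx hij.le
    have h2 := mul_lt_mul_of_pos_left (rho_mem_sortedBy s hij) hε
    simp only [Function.comp_apply, Pi.add_apply, Pi.smul_apply, smul_eq_mul] at h2 ⊢
    linarith

lemma exists_mem_closure_sortedBy {n : ℕ} (x : Fin n → ℝ) :
    ∃ s : Equiv.Perm (Fin n), x ∈ closure (sortedBy s) :=
  ⟨Tuple.sort x, (mem_closure_sortedBy_iff _ _).2 (Tuple.monotone_sort x)⟩

lemma dense_distinctPoints (n : ℕ) : Dense (distinctPoints n) := fun x =>
  let ⟨s, hs⟩ := exists_mem_closure_sortedBy x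
  closure_mono (sortedBy_subset_distinctPoints s) hs

lemma mem_sortedBy_of_mem_closure {n : ℕ} {s : Equiv.Perm (Fin n)} {x : Fin n → ℝ}
    (hx : x ∈ closure (sortedBy s)) (hd : x ∈ distinctPoints n) : x ∈ sortedBy s :=
  ((mem_closure_sortedBy_iff s x).1 hx).strictMono_of_injective
    (Function.Injective.comp hd s.injective)

lemma perm_apply_eq_of_strictMonoOn {n : ℕ} {σ : Equiv.Perm (Fin n)} {A : Set (Fin n)}
    (hA : σ '' A = A) (hσ : StrictMonoOn σ A) : ∀ x ∈ A, σ x = x := by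
  intro x
  induction x using WellFoundedLT.induction with
  | ind x ih =>
    intro hx
    rcases lt_trichotomy (σ x) x with h | h | h
    · exact σ.injective (ih _ h (hA ▸ Set.mem_image_of_mem σ hx))
    · exact h
    · obtain ⟨y, hy, hyx⟩ : x ∈ σ '' A := hA.symm ▸ hx
      have hlt : y < x := (hσ.lt_iff_lt hy hx).1 (hyx ▸ h)
      have := ih y hlt hy
      exact absurd (this.symm.trans hyx) hlt.ne

lemma perm_eq_one_of_strictMono {n : ℕ} {σ : Equiv.Perm (Fin n)} (hσ : StrictMono σ) : σ = 1 :=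
  Equiv.ext fun x => perm_apply_eq_of_strictMonoOn (A := Set.univ)
    (Set.image_univ_of_surjective σ.surjective) (hσ.strictMonoOn _) x trivial

lemma eq_of_mem_sortedBy {n : ℕ} {s t : Equiv.Perm (Fin n)} {x : Fin n → ℝ}
    (hs : x ∈ sortedBy s) (ht : x ∈ sortedBy t) : s = t := by
  have h : StrictMono (t⁻¹ * s) := fun i j hij => by
    have h1 : x (s i) < x (s j) := hs hij
    rw [← StrictMono.lt_iff_lt ht]
    simpa using h1
  exact (inv_mul_eq_one.1 (perm_eq_one_of_strictMono h)).symm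

lemma smul_apply {n : ℕ} (s : Equiv.Perm (Fin n)) (x : Fin n → ℝ) (i : Fin n) :
    (s • x) i = x (s⁻¹ i) := rfl

lemma smul_mem_sortedBy {n : ℕ} {g s : Equiv.Perm (Fin n)} {x : Fin n → ℝ}
    (hx : x ∈ sortedBy s) : g • x ∈ sortedBy (g * s) := fun i j hij => by
  simpa [smul_apply] using hx hij

lemma smul_mem_closure_sortedBy {n : ℕ} {g s : Equiv.Perm (Fin n)} {x : Fin n → ℝ}
    (hx : x ∈ closure (sortedBy s)) : g • x ∈ closure (sortedBy (g * s)) := by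
  rw [mem_closure_sortedBy_iff] at hx ⊢
  exact fun i j hij => by simpa [smul_apply] using hx hij

lemma continuous_perm_smul {n : ℕ} (g : Equiv.Perm (Fin n)) :
    Continuous fun x : Fin n → ℝ => g • x :=
  continuous_pi fun i => continuous_apply (g⁻¹ i)

/-! ### Galleries of adjacent chambers -/

/-- Two elements of `R` that differ by right multiplication by an adjacent transposition. -/
def GalleryStep {n : ℕ} (R : Set (Equiv.Perm (Fin n))) (s t : Equiv.Perm (Fin n)) : Prop :=
  s ∈ R ∧ t ∈ R ∧ ∃ j j' : Fin n, (j : ℕ) + 1 = j' ∧ t = s * Equiv.swap j j'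

/-- The points whose entries increase along `s 0, s 1, …`, except perhaps from `s j` to `s j'`. -/
def almostSortedBy {n : ℕ} (s : Equiv.Perm (Fin n)) (j j' : Fin n) : Set (Fin n → ℝ) :=
  {x | ∀ a b, a < b → ¬(a = j ∧ b = j') → x (s a) < x (s b)}

lemma isOpen_almostSortedBy {n : ℕ} (s : Equiv.Perm (Fin n)) (j j' : Fin n) :
    IsOpen (almostSortedBy s j j') := by
  have : almostSortedBy s j j' = ⋂ a, ⋂ b, ⋂ _ : a < b, ⋂ _ : ¬(a = j ∧ b = j'),
      {x : Fin n → ℝ | x (s a) < x (s b)} := by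
    ext x
    simp only [almostSortedBy, Set.mem_iInter]
    rfl
  rw [this]
  exact isOpen_iInter_of_finite fun a => isOpen_iInter_of_finite fun b =>
    isOpen_iInter_of_finite fun _ => isOpen_iInter_of_finite fun _ =>
      isOpen_lt (continuous_apply _) (continuous_apply _)

lemma convex_almostSortedBy {n : ℕ} (s : Equiv.Perm (Fin n)) (j j' : Fin n) :
    Convex ℝ (almostSortedBy s j j') := by
  intro x hx y hy a b ha hb hab i k hik hne
  have h1 : x (s i) < x (s k) := hx i k hik hne
  have h2 : y (s i) < y (s k) := hy i k hik hne
  simp only [Pi.add_apply, Pi.smul_apply, smul_eq_mul]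
  rcases ha.eq_or_lt with rfl | ha
  · obtain rfl : b = 1 := by linarith
    simpa using h2
  · nlinarith [mul_lt_mul_of_pos_left h1 ha, mul_le_mul_of_nonneg_left h2.le hb]

lemma sortedBy_subset_almostSortedBy {n : ℕ} (s : Equiv.Perm (Fin n)) (j j' : Fin n) :
    sortedBy s ⊆ almostSortedBy s j j' := fun _ hx _ _ hab _ => hx hab

lemma swap_lt_swap {n : ℕ} {j j' a b : Fin n} (hj : (j : ℕ) + 1 = j') (hab : a < b)
    (hne : ¬(a = j ∧ b = j')) : Equiv.swap j j' a < Equiv.swap j j' b := by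
  simp only [Equiv.swap_apply_def]
  simp only [Fin.ext_iff] at hne ⊢
  rw [Fin.lt_def] at hab ⊢
  split_ifs <;> omega

lemma sortedBy_mul_swap_subset {n : ℕ} (s : Equiv.Perm (Fin n)) {j j' : Fin n}
    (hj : (j : ℕ) + 1 = j') : sortedBy (s * Equiv.swap j j') ⊆ almostSortedBy s j j' := by
  intro x hx a b hab hne
  simpa using hx (swap_lt_swap hj hab hne)

/-- This open convex region joins two adjacent cones across their common wall; comparing the entries
at `s j` and `s j'` decides the side. -/
lemma almostSortedBy_subset {n : ℕ} (s : Equiv.Perm (Fin n)) {j j' : Fin n}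
    (hj : (j : ℕ) + 1 = j') : almostSortedBy s j j' ⊆
      closure (sortedBy s) ∪ closure (sortedBy (s * Equiv.swap j j')) := by
  intro x hx
  simp only [Set.mem_union, mem_closure_sortedBy_iff]
  rcases le_total (x (s j)) (x (s j')) with h | h
  · left
    intro a b hab
    rcases hab.eq_or_lt with rfl | hab
    · exact le_rfl
    by_cases hne : a = j ∧ b = j'
    · rw [hne.1, hne.2]; exact h
    · exact (hx a b hab hne).le
  · right
    intro a b hab
    rcases hab.eq_or_lt with rfl | hab
    · exact le_rfl
    by_cases hne : a = j ∧ b = j'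
    · rw [hne.1, hne.2]; simpa using h
    · refine (hx _ _ (swap_lt_swap hj hab hne) ?_).le
      rintro ⟨h1, h2⟩
      have ha : a = j' := by simpa using congrArg (Equiv.swap j j') h1
      have hb : b = j := by simpa using congrArg (Equiv.swap j j') h2
      subst ha hb
      rw [Fin.lt_def] at hab
      omega

/-- The interior of the union of the closed chambers of `R`. -/
def chamberDomain {n : ℕ} (R : Set (Equiv.Perm (Fin n))) : Set (Fin n → ℝ) :=
  interior (⋃ r ∈ R, closure (sortedBy r))

lemma sortedBy_subset_chamberDomain {n : ℕ} {R : Set (Equiv.Perm (Fin n))}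
    {r : Equiv.Perm (Fin n)} (hr : r ∈ R) : sortedBy r ⊆ chamberDomain R :=
  interior_maximal (subset_closure.trans
    (Set.subset_biUnion_of_mem (u := fun r => closure (sortedBy r)) hr)) (isOpen_sortedBy r)

lemma closure_sortedBy_subset_closure_chamberDomain {n : ℕ} {R : Set (Equiv.Perm (Fin n))}
    {r : Equiv.Perm (Fin n)} (hr : r ∈ R) : closure (sortedBy r) ⊆ closure (chamberDomain R) :=
  closure_mono (sortedBy_subset_chamberDomain hr)

lemma isConnected_chamberDomain {n : ℕ} {R : Set (Equiv.Perm (Fin n))} (h1 : 1 ∈ R)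
    (hR : ∀ r ∈ R, Relation.ReflTransGen (GalleryStep R) r 1) :
    IsConnected (chamberDomain R) := by
  have hmem : rho 1 ∈ chamberDomain R := sortedBy_subset_chamberDomain h1 (rho_mem_sortedBy 1)
  set S := connectedComponentIn (chamberDomain R) (rho 1)
  have hS : ∀ r ∈ R, sortedBy r ⊆ S := by
    intro r hr
    induction hR r hr using Relation.ReflTransGen.head_induction_on with
    | refl =>
      exact (convex_sortedBy 1).isPreconnected.subset_connectedComponentIn
        (rho_mem_sortedBy 1) (sortedBy_subset_chamberDomain h1)
    | @head s t hst _ ih =>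
      obtain ⟨hs, ht, j, j', hj, rfl⟩ := hst
      have hsub : almostSortedBy s j j' ⊆ chamberDomain R := by
        refine interior_maximal ((almostSortedBy_subset s hj).trans (Set.union_subset ?_ ?_))
          (isOpen_almostSortedBy s j j')
        · exact Set.subset_biUnion_of_mem (u := fun r => closure (sortedBy r)) hs
        · exact Set.subset_biUnion_of_mem (u := fun r => closure (sortedBy r)) ht
      have hx := rho_mem_sortedBy (s * Equiv.swap j j')
      have hxS := ih ht hx
      have := (convex_almostSortedBy s j j').isPreconnected.subset_connectedComponentIn
        (sortedBy_mul_swap_subset s hj hx) hsub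
      rw [← connectedComponentIn_eq hxS] at this
      exact (sortedBy_subset_almostSortedBy s j j').trans this
  refine ⟨⟨_, hmem⟩, ?_⟩
  -- The domain lies between the component of `rho 1` and its closure, since that component contains
  -- every open cone of `R`.
  refine IsPreconnected.subset_closure isPreconnected_connectedComponentIn
    (connectedComponentIn_subset _ (rho 1)) ?_
  refine interior_subset.trans (Set.iUnion₂_subset fun r hr => closure_mono (hS r hr))

lemma exists_mem_sortedBy_of_mem_chamberDomain {n : ℕ} {R : Set (Equiv.Perm (Fin n))}
    {x : Fin n → ℝ} (hx : x ∈ chamberDomain R) (hd : x ∈ distinctPoints n) :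
    ∃ r ∈ R, x ∈ sortedBy r := by
  obtain ⟨r, hr, hxr⟩ := Set.mem_iUnion₂.1 (interior_subset hx)
  exact ⟨r, hr, mem_sortedBy_of_mem_closure hxr hd⟩

/-- Disjointness need only be tested at points with distinct entries, which are dense; each lies in
a single cone. It also gives the one-point condition: if `g • x` is in the closure, its open
neighbourhood `g • chamberDomain R` meets the domain, so `g = 1`. -/
lemma isFundamentalDomain_chamberDomain {n : ℕ} (G : Subgroup (Equiv.Perm (Fin n)))
    {R : Set (Equiv.Perm (Fin n))} (hcov : ∀ s, ∃ g ∈ G, ∃ r ∈ R, s = g * r)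
    (huniq : ∀ g ∈ G, ∀ r ∈ R, ∀ r' ∈ R, g * r = r' → g = 1)
    (h1 : 1 ∈ R) (hR : ∀ r ∈ R, Relation.ReflTransGen (GalleryStep R) r 1) :
    IsFundamentalDomain G (chamberDomain R) := by
  have hop (g : G) : IsOpen (g • chamberDomain R) := by
    have : g • chamberDomain R = (fun x : Fin n → ℝ => (g⁻¹ : Equiv.Perm (Fin n)) • x) ⁻¹'
        chamberDomain R := by
      ext x
      exact Set.mem_smul_set_iff_inv_smul_mem
    rw [this]
    exact isOpen_interior.preimage (continuous_perm_smul _)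
  have hdisj (g : G) (hg : g ≠ 1) : Disjoint (g • chamberDomain R) (chamberDomain R) := by
    rw [Set.disjoint_iff_inter_eq_empty, ← Set.not_nonempty_iff_eq_empty]
    intro hne
    obtain ⟨x, ⟨hx1, hx2⟩, hxd⟩ :=
      (dense_distinctPoints n).inter_open_nonempty _ ((hop g).inter isOpen_interior) hne
    obtain ⟨y, hy, rfl⟩ := hx1
    have hyd : y ∈ distinctPoints n := by
      have hi : Function.Injective (y ∘ ((g : Equiv.Perm (Fin n))⁻¹ : Equiv.Perm (Fin n))) := hxd
      exact (Function.Injective.of_comp_iff' y (Equiv.bijective _)).1 hi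
    obtain ⟨r, hr, hyr⟩ := exists_mem_sortedBy_of_mem_chamberDomain hy hyd
    obtain ⟨r', hr', hxr⟩ := exists_mem_sortedBy_of_mem_chamberDomain hx2 hxd
    have heq := eq_of_mem_sortedBy (smul_mem_sortedBy (g := g) hyr) hxr
    exact hg (Subtype.ext (huniq g g.2 r hr r' hr' heq))
  refine ⟨isOpen_interior, isConnected_chamberDomain h1 hR, fun x => ?_, fun x hx g hg => ?_,
    hdisj⟩
  · obtain ⟨s, hs⟩ := exists_mem_closure_sortedBy x
    obtain ⟨g, hg, r, hr, rfl⟩ := hcov s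
    refine ⟨⟨g⁻¹, inv_mem hg⟩, closure_sortedBy_subset_closure_chamberDomain hr ?_⟩
    have := smul_mem_closure_sortedBy (g := g⁻¹) hs
    rwa [inv_mul_cancel_left] at this
  · by_cases h : g = 1
    · rw [h, one_smul]
    · have hne := mem_closure_iff.1 hg _ (hop g) (Set.smul_mem_smul_set hx)
      exact absurd hne (Set.not_nonempty_iff_eq_empty.2
        (Set.disjoint_iff_inter_eq_empty.1 (hdisj g h)))

/-! ### Sets of permutations closed under removing descents -/

/-- The sets of permutations closed under exchanging the values at a descent. -/
def DescentClosed {n : ℕ} (D : Set (Equiv.Perm (Fin n))) : Prop :=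
  ∀ s ∈ D, ∀ j j' : Fin n, (j : ℕ) + 1 = j' → s j' < s j → s * Equiv.swap j j' ∈ D

lemma eq_one_of_forall_lt {n : ℕ} {s : Equiv.Perm (Fin n)}
    (h : ∀ j j' : Fin n, (j : ℕ) + 1 = j' → ¬ s j' < s j) : s = 1 := by
  cases n with
  | zero => exact Subsingleton.elim _ _
  | succ n =>
    refine perm_eq_one_of_strictMono (Fin.strictMono_iff_lt_succ.2 fun i => ?_)
    refine lt_of_le_of_ne (not_lt.1 (h i.castSucc i.succ (by simp))) fun he => ?_
    exact (Fin.castSucc_lt_succ (i := i)).ne (s.injective he)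

/-- Makes the removal of descents terminate: `j` is the first position that changes, and its value
drops. -/
lemma toLex_mul_swap_lt {n : ℕ} {s : Equiv.Perm (Fin n)} {j j' : Fin n}
    (hj : (j : ℕ) + 1 = j') (h : s j' < s j) :
    toLex (⇑(s * Equiv.swap j j') : Fin n → Fin n) < toLex (⇑s) := by
  refine ⟨j, fun a ha => ?_, ?_⟩
  · have h1 : a ≠ j := ha.ne
    have h2 : a ≠ j' := by
      rintro rfl
      have : (a : ℕ) < j := ha
      omega
    change (s * Equiv.swap j j') a = s a
    rw [Equiv.Perm.mul_apply, Equiv.swap_apply_of_ne_of_ne h1 h2]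
  · change (s * Equiv.swap j j') j < s j
    simpa using h

lemma DescentClosed.reflTransGen {n : ℕ} {D : Set (Equiv.Perm (Fin n))} (hD : DescentClosed D)
    {A : Set (Equiv.Perm (Fin n))} {a : Equiv.Perm (Fin n)} (ha : a ∈ A) :
    ∀ d ∈ D, Relation.ReflTransGen (GalleryStep (A * D)) (a * d) a := by
  intro d
  induction d using (InvImage.wf (fun d : Equiv.Perm (Fin n) => toLex (⇑d : Fin n → Fin n))
    wellFounded_lt).induction with
  | h d ih =>
    intro hd
    by_cases h : ∃ j j' : Fin n, (j : ℕ) + 1 = j' ∧ d j' < d j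
    · obtain ⟨j, j', hj, hlt⟩ := h
      have hd' := hD d hd j j' hj hlt
      exact (ih _ (toLex_mul_swap_lt hj hlt) hd').head
        ⟨Set.mul_mem_mul ha hd, Set.mul_mem_mul ha hd', j, j', hj, (mul_assoc _ _ _).symm⟩
    · push Not at h
      have := eq_one_of_forall_lt fun j j' hj => (h j j' hj).not_gt
      rw [this, mul_one]

/-- The gallery first runs from `a * d` to `a`, then follows the one in `A`, which is contained in
`A * D` because `1 ∈ D`. -/
lemma reflTransGen_mul {n : ℕ} {A D : Set (Equiv.Perm (Fin n))} (hD : DescentClosed D)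
    (h1 : 1 ∈ D) (hA : ∀ a ∈ A, Relation.ReflTransGen (GalleryStep A) a 1) :
    ∀ r ∈ A * D, Relation.ReflTransGen (GalleryStep (A * D)) r 1 := by
  rintro _ ⟨a, ha, d, hd, rfl⟩
  refine (hD.reflTransGen ha d hd).trans (Relation.ReflTransGen.mono ?_ _ _ (hA a ha))
  rintro s t ⟨hs, ht, h⟩
  exact ⟨⟨s, hs, 1, h1, mul_one s⟩, ⟨t, ht, 1, h1, mul_one t⟩, h⟩

/-! ### Invariant sets of permutations -/

/-- The permutation `s` maps the set `A` onto itself. -/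
def Preserves {α : Type*} (s : Equiv.Perm α) (A : Set α) : Prop := ∀ x, s x ∈ A ↔ x ∈ A

lemma image_eq_iff_preserves {α : Type*} {s : Equiv.Perm α} {A : Set α} :
    s '' A = A ↔ Preserves s A := by
  rw [eq_comm, ← Set.preimage_eq_iff_eq_image s.bijective]
  exact Set.ext_iff

lemma Preserves.mul {α : Type*} {s t : Equiv.Perm α} {A : Set α} (hs : Preserves s A)
    (ht : Preserves t A) : Preserves (s * t) A := fun x => (hs (t x)).trans (ht x)

lemma Preserves.inv {α : Type*} {s : Equiv.Perm α} {A : Set α} (hs : Preserves s A) :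
    Preserves s⁻¹ A := fun x => by simpa using (hs (s⁻¹ x)).symm

lemma Preserves.diff {α : Type*} {s : Equiv.Perm α} {A B : Set α} (hA : Preserves s A)
    (hB : Preserves s B) : Preserves s (A \ B) := fun x => and_congr (hA x) (not_congr (hB x))

lemma mem_youngSet_iff {n : ℕ} {P : Set (Set (Fin n))} {s : Equiv.Perm (Fin n)} :
    s ∈ youngSet P ↔ ∀ A ∈ P, Preserves s A :=
  forall₂_congr fun _ _ => image_eq_iff_preserves

lemma mul_mem_youngSet {n : ℕ} {P : Set (Set (Fin n))} {s t : Equiv.Perm (Fin n)}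
    (hs : s ∈ youngSet P) (ht : t ∈ youngSet P) : s * t ∈ youngSet P := by
  rw [mem_youngSet_iff] at *
  exact fun A hA => (hs A hA).mul (ht A hA)

lemma inv_mem_youngSet {n : ℕ} {P : Set (Set (Fin n))} {s : Equiv.Perm (Fin n)}
    (hs : s ∈ youngSet P) : s⁻¹ ∈ youngSet P := by
  rw [mem_youngSet_iff] at *
  exact fun A hA => (hs A hA).inv

lemma one_mem_youngSet {n : ℕ} (P : Set (Set (Fin n))) : 1 ∈ youngSet P :=
  mem_youngSet_iff.2 fun _ _ _ => Iff.rfl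

lemma mem_symOn_iff {n : ℕ} {Ω : Set (Fin n)} {s : Equiv.Perm (Fin n)} :
    s ∈ symOn Ω ↔ ∀ x, x ∉ Ω → s x = x := mem_fixingSubgroup_iff _

lemma preserves_of_mem_symOn {n : ℕ} {Ω : Set (Fin n)} {s : Equiv.Perm (Fin n)}
    (hs : s ∈ symOn Ω) : Preserves s Ω := by
  rw [mem_symOn_iff] at hs
  intro x
  by_cases hx : x ∈ Ω
  · refine iff_of_true (by_contra fun h => h ?_) hx
    rwa [s.injective (hs _ h)]
  · rw [hs x hx]

lemma preserves_of_mem_symOn_of_disjoint {n : ℕ} {Ω A : Set (Fin n)} {s : Equiv.Perm (Fin n)}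
    (hs : s ∈ symOn Ω) (hA : Disjoint Ω A) : Preserves s A := by
  intro x
  by_cases hx : x ∈ Ω
  · exact iff_of_false (hA.notMem_of_mem_left ((preserves_of_mem_symOn hs x).2 hx))
      (hA.notMem_of_mem_left hx)
  · rw [mem_symOn_iff.1 hs x hx]

lemma symOn_mono {n : ℕ} {A B : Set (Fin n)} (h : A ⊆ B) : symOn A ≤ symOn B := fun _ hs =>
  mem_symOn_iff.2 fun x hx => mem_symOn_iff.1 hs x fun hA => hx (h hA)

lemma exists_mem_symOn_eqOn {n : ℕ} {A : Set (Fin n)} {s : Equiv.Perm (Fin n)}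
    (hs : Preserves s A) : ∃ t ∈ symOn A, ∀ x ∈ A, t x = s x := by
  classical
  refine ⟨Equiv.Perm.ofSubtype (s.subtypePerm (p := (· ∈ A)) hs),
    mem_symOn_iff.2 fun x hx => Equiv.Perm.ofSubtype_apply_of_not_mem _ hx, fun x hx => ?_⟩
  rw [Equiv.Perm.ofSubtype_apply_of_mem _ hx]
  rfl

lemma mem_symOn_mul_symOn {n : ℕ} {Δ Γ : Set (Fin n)} {s : Equiv.Perm (Fin n)}
    (hs : s ∈ symOn Γ) (hsΔ : Preserves s Δ) :
    s ∈ (symOn Δ : Set (Equiv.Perm (Fin n))) * (symOn (Γ \ Δ) : Set (Equiv.Perm (Fin n))) := by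
  obtain ⟨t, ht, hts⟩ := exists_mem_symOn_eqOn hsΔ
  refine ⟨t, ht, t⁻¹ * s, mem_symOn_iff.2 fun x hx => ?_, mul_inv_cancel_left t s⟩
  rw [Equiv.Perm.mul_apply, Equiv.Perm.inv_eq_iff_eq]
  by_cases hxΔ : x ∈ Δ
  · exact (hts x hxΔ).symm
  · rw [mem_symOn_iff.1 hs x fun h => hx ⟨h, hxΔ⟩, mem_symOn_iff.1 ht x hxΔ]

lemma exists_mem_symOn_strictMonoOn {n : ℕ} (A : Set (Fin n)) (f : Equiv.Perm (Fin n)) :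
    ∃ s ∈ symOn A, StrictMonoOn ⇑(f * s) A := by
  classical
  let o := A.toFinset.orderIsoOfFin rfl
  let e : Fin A.toFinset.card ≃ {x // x ∈ A} :=
    o.toEquiv.trans (Equiv.subtypeEquivRight fun _ => Set.mem_toFinset)
  have he : ∀ i j, (e i : Fin n) < e j ↔ i < j := fun i j => o.lt_iff_lt
  let σ : Equiv.Perm (Fin A.toFinset.card) := Tuple.sort fun i => f (e i)
  have hσ : StrictMono fun i => f (e (σ i)) :=
    (Tuple.monotone_sort fun i => f (e i)).strictMono_of_injective
      (f.injective.comp (Subtype.val_injective.comp (e.injective.comp σ.injective)))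
  refine ⟨σ.extendDomain e, mem_symOn_iff.2 fun x hx =>
    Equiv.Perm.extendDomain_apply_not_subtype _ _ hx, ?_⟩
  intro x hx y hy hxy
  obtain ⟨i, hi⟩ := e.surjective ⟨x, hx⟩
  obtain ⟨j, hj⟩ := e.surjective ⟨y, hy⟩
  obtain rfl : (e i : Fin n) = x := congrArg Subtype.val hi
  obtain rfl : (e j : Fin n) = y := congrArg Subtype.val hj
  simp only [Equiv.Perm.mul_apply, Equiv.Perm.extendDomain_apply_image]
  exact hσ ((he i j).1 hxy)

/-! ### Products of transpositions -/

lemma prod_swaps_apply {n l : ℕ} {d e : Fin l → Fin n} (hd : Function.Injective d)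
    (he : Function.Injective e) (hde : ∀ t t', d t ≠ e t') :
    (∀ t, (List.ofFn fun t => Equiv.swap (d t) (e t)).prod (d t) = e t) ∧
    (∀ t, (List.ofFn fun t => Equiv.swap (d t) (e t)).prod (e t) = d t) ∧
    ∀ x, (∀ t, x ≠ d t) → (∀ t, x ≠ e t) →
      (List.ofFn fun t => Equiv.swap (d t) (e t)).prod x = x := by
  induction l with
  | zero => exact ⟨fun t => t.elim0, fun t => t.elim0, fun x _ _ => by simp⟩
  | succ l ih =>
    obtain ⟨ih1, ih2, ih3⟩ := ih (d := fun t => d t.succ) (e := fun t => e t.succ)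
      (hd.comp (Fin.succ_injective l)) (he.comp (Fin.succ_injective l)) fun t t' => hde _ _
    simp only [List.ofFn_succ, List.prod_cons, Equiv.Perm.mul_apply]
    refine ⟨fun t => ?_, fun t => ?_, fun x hx hx' => ?_⟩
    · cases t using Fin.cases with
      | zero =>
        rw [ih3 _ (fun t h => (Fin.succ_ne_zero t).symm (hd h)) fun t => hde _ _,
          Equiv.swap_apply_left]
      | succ t =>
        rw [ih1, Equiv.swap_apply_of_ne_of_ne (hde _ _).symm (he.ne (Fin.succ_ne_zero t))]
    · cases t using Fin.cases with
      | zero =>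
        rw [ih3 _ (fun t => (hde _ _).symm) fun t h => (Fin.succ_ne_zero t).symm (he h),
          Equiv.swap_apply_right]
      | succ t =>
        rw [ih2, Equiv.swap_apply_of_ne_of_ne (hd.ne (Fin.succ_ne_zero t)) (hde _ _)]
    · rw [ih3 x (fun t => hx _) fun t => hx' _, Equiv.swap_apply_of_ne_of_ne (hx _) (hx' _)]

lemma swapProducts_subset_symOn {n : ℕ} {Δ Γ : Set (Fin n)} (hΔ : Δ ⊆ Γ) :
    swapProducts Δ Γ ⊆ symOn Γ := by
  rintro _ ⟨l, d, e, -, -, hd, he, rfl⟩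
  refine Subgroup.list_prod_mem _ fun x hx => ?_
  obtain ⟨t, rfl⟩ := (List.mem_ofFn' _ _).1 hx
  refine mem_symOn_iff.2 fun x hx => Equiv.swap_apply_of_ne_of_ne ?_ ?_
  · rintro rfl; exact hx (hΔ (hd t))
  · rintro rfl; exact hx (he t).1

lemma exists_mem_swapProducts {n : ℕ} {Δ Γ : Set (Fin n)} {u : Equiv.Perm (Fin n)}
    (hu : u ∈ symOn Γ) (hΔ : Δ ⊆ Γ) : ∃ v ∈ swapProducts Δ Γ, ∀ x, v x ∈ Δ ↔ u x ∈ Δ := by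
  classical
  set D := Δ.toFinset
  set D' := D.map u⁻¹.toEmbedding
  have hD' : ∀ x, x ∈ D' ↔ u x ∈ Δ := fun x => by
    simp only [D', D, Finset.mem_map, Set.mem_toFinset]
    constructor
    · rintro ⟨y, hy, rfl⟩
      simpa using hy
    · exact fun h => ⟨u x, h, by simp⟩
  have hD : ∀ x, x ∈ D ↔ x ∈ Δ := fun x => Set.mem_toFinset
  -- `D'` is the preimage of `Δ` under `u`, so it has the size of `D`. Exchanging `D \ D'` with `D'
  -- \ D` gives a `v` with that same preimage of `Δ`.
  have hcard : (D' \ D).card = (D \ D').card :=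
    Finset.card_sdiff_comm (Finset.card_map _)
  set d := (D \ D').orderEmbOfFin rfl
  set e := (D' \ D).orderEmbOfFin hcard
  have hd : ∀ t, d t ∈ D \ D' := fun t => Finset.orderEmbOfFin_mem _ _ t
  have he : ∀ t, e t ∈ D' \ D := fun t => Finset.orderEmbOfFin_mem _ _ t
  have hd' : ∀ x ∈ D \ D', ∃ t, d t = x := fun x hx => by
    have : x ∈ Set.range d := by rw [Finset.range_orderEmbOfFin]; exact hx
    exact this
  have he' : ∀ x ∈ D' \ D, ∃ t, e t = x := fun x hx => by
    have : x ∈ Set.range e := by rw [Finset.range_orderEmbOfFin]; exact hx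
    exact this
  simp only [Finset.mem_sdiff, hD, hD'] at hd he hd' he'
  obtain ⟨h1, h2, h3⟩ := prod_swaps_apply d.injective e.injective
    fun t t' h => (he t').2 (h ▸ (hd t).1)
  refine ⟨_, ⟨_, d, e, d.strictMono, e.strictMono, fun t => (hd t).1,
    fun t => ⟨?_, (he t).2⟩, rfl⟩, fun x => ?_⟩
  · exact (preserves_of_mem_symOn hu _).1 (hΔ (he t).1)
  · by_cases hx : ∃ t, d t = x
    · obtain ⟨t, rfl⟩ := hx
      rw [h1]
      exact iff_of_false (he t).2 (hd t).2
    by_cases hx' : ∃ t, e t = x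
    · obtain ⟨t, rfl⟩ := hx'
      rw [h2]
      exact iff_of_true (hd t).1 (he t).1
    rw [h3 x (fun t h => hx ⟨t, h.symm⟩) fun t h => hx' ⟨t, h.symm⟩]
    constructor
    · exact fun h => by_contra fun h' => hx (hd' x ⟨h, h'⟩)
    · exact fun h => by_contra fun h' => hx' (he' x ⟨h, h'⟩)

lemma strictMonoOn_rho_iff {n : ℕ} {u : Equiv.Perm (Fin n)} {A : Set (Fin n)} :
    StrictMonoOn (rho u) A ↔ StrictMonoOn ⇑u⁻¹ A := by
  simp only [StrictMonoOn, rho_lt_rho_iff]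

/-- Eliminates the transpositions: for any `u` in `symOn Γ` some swap product `v` has the same
preimage of `Δ`, so `u * v⁻¹` preserves `Δ` and splits as required. Only the two monotonicity
conditions remain. -/
lemma mem_modifiedTransversal_iff {n : ℕ} {Δ Γ : Set (Fin n)} (hΔ : Δ ⊆ Γ)
    {u : Equiv.Perm (Fin n)} : u ∈ modifiedTransversal Δ Γ ↔
      u ∈ symOn Γ ∧ StrictMonoOn ⇑u⁻¹ Δ ∧ StrictMonoOn ⇑u⁻¹ (Γ \ Δ) := by
  constructor
  · rintro ⟨v, hv, g, ⟨g₁, hg₁, g₂, hg₂, rfl⟩, rfl, h1, h2⟩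
    exact ⟨mul_mem (mul_mem (symOn_mono hΔ hg₁) (symOn_mono Set.sdiff_subset hg₂))
      (swapProducts_subset_symOn hΔ hv), strictMonoOn_rho_iff.1 h1, strictMonoOn_rho_iff.1 h2⟩
  · rintro ⟨hu, h1, h2⟩
    obtain ⟨v, hv, hvu⟩ := exists_mem_swapProducts hu hΔ
    refine ⟨v, hv, u * v⁻¹, mem_symOn_mul_symOn
      (mul_mem hu (inv_mem (swapProducts_subset_symOn hΔ hv))) fun x => ?_, by simp,
      strictMonoOn_rho_iff.2 h1, strictMonoOn_rho_iff.2 h2⟩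
    rw [Equiv.Perm.mul_apply, ← hvu]
    simp

lemma one_mem_modifiedTransversal {n : ℕ} {Δ Γ : Set (Fin n)} (hΔ : Δ ⊆ Γ) :
    1 ∈ modifiedTransversal Δ Γ :=
  (mem_modifiedTransversal_iff hΔ).2 ⟨one_mem _, fun _ _ _ _ h => h, fun _ _ _ _ h => h⟩

lemma exists_mul_mem_modifiedTransversal {n : ℕ} {Δ Γ : Set (Fin n)} (hΔ : Δ ⊆ Γ)
    {h : Equiv.Perm (Fin n)} (hh : Preserves h Γ) :
    ∃ l, ∃ u ∈ modifiedTransversal Δ Γ, Preserves l Δ ∧ h = l * u := by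
  obtain ⟨t, ht, hth⟩ := exists_mem_symOn_eqOn hh
  -- Sorting `t⁻¹` separately on `Δ` and on `Γ \ Δ` picks the representative of the coset.
  obtain ⟨σ, hσ, hσm⟩ := exists_mem_symOn_strictMonoOn Δ t⁻¹
  obtain ⟨τ, hτ, hτm⟩ := exists_mem_symOn_strictMonoOn (Γ \ Δ) t⁻¹
  have hu : (σ * τ)⁻¹ * t ∈ modifiedTransversal Δ Γ := by
    rw [mem_modifiedTransversal_iff hΔ]
    refine ⟨mul_mem (inv_mem (mul_mem (symOn_mono hΔ hσ) (symOn_mono Set.sdiff_subset hτ))) ht,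
      hσm.congr fun x hx => ?_, hτm.congr fun x hx => ?_⟩
    · have : τ x = x := mem_symOn_iff.1 hτ x fun h => h.2 hx
      simp [this]
    · have : σ (τ x) = τ x := mem_symOn_iff.1 hσ _ ((preserves_of_mem_symOn hτ x).2 hx).2
      simp [this]
  refine ⟨h * t⁻¹ * (σ * τ), _, hu, Preserves.mul (fun x => ?_) (Preserves.mul
    (preserves_of_mem_symOn hσ) (preserves_of_mem_symOn_of_disjoint hτ Set.disjoint_sdiff_left)),
    by group⟩
  have hfix : ∀ x ∈ Γ, (h * t⁻¹) x = x := fun x hx => by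
    have := hth (t⁻¹ x) ((preserves_of_mem_symOn (inv_mem ht) x).2 hx)
    simpa using this.symm
  by_cases hx : x ∈ Γ
  · rw [hfix x hx]
  · have hp : Preserves (h * t⁻¹) Γ := hh.mul (preserves_of_mem_symOn ht).inv
    exact iff_of_false (fun h' => hx ((hp x).1 (hΔ h'))) fun h' => hx (hΔ h')

/-- The quotient `l⁻¹ * l' = u * u'⁻¹` preserves `Δ` and `Γ \ Δ` and is increasing on each, hence
trivial there; outside `Γ` both `u` and `u'` are trivial. -/
lemma eq_of_mul_eq_mul_modifiedTransversal {n : ℕ} {Δ Γ : Set (Fin n)} (hΔ : Δ ⊆ Γ)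
    {l l' u u' : Equiv.Perm (Fin n)} (hl : Preserves l Δ) (hlΓ : Preserves l Γ)
    (hl' : Preserves l' Δ) (hlΓ' : Preserves l' Γ) (hu : u ∈ modifiedTransversal Δ Γ)
    (hu' : u' ∈ modifiedTransversal Δ Γ) (h : l * u = l' * u') : u = u' := by
  rw [mem_modifiedTransversal_iff hΔ] at hu hu'
  have hmu : l⁻¹ * l' = u * u'⁻¹ := by
    rw [eq_mul_inv_iff_mul_eq, mul_assoc, ← h, inv_mul_cancel_left]
  have key : ∀ A, Preserves (l⁻¹ * l') A → StrictMonoOn ⇑u⁻¹ A → StrictMonoOn ⇑u'⁻¹ A →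
      ∀ x ∈ A, (l⁻¹ * l') x = x := by
    intro A hA h1 h2
    refine perm_apply_eq_of_strictMonoOn (image_eq_iff_preserves.2 hA) fun x hx y hy hxy => ?_
    rw [← h1.lt_iff_lt ((hA x).2 hx) ((hA y).2 hy), hmu]
    simpa using h2 hx hy hxy
  have hone : l⁻¹ * l' = 1 := by
    ext1 x
    by_cases hx : x ∈ Γ
    · by_cases hxΔ : x ∈ Δ
      · exact key Δ (hl.inv.mul hl') hu.2.1 hu'.2.1 x hxΔ
      · exact key (Γ \ Δ) ((hlΓ.inv.mul hlΓ').diff (hl.inv.mul hl')) hu.2.2 hu'.2.2 x ⟨hx, hxΔ⟩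
    · rw [hmu]
      exact mem_symOn_iff.1 (mul_mem hu.1 (inv_mem hu'.1)) x hx
  rw [hone, eq_comm, mul_inv_eq_one] at hmu
  exact hmu

lemma strictMonoOn_mul_swap_inv {n : ℕ} {s : Equiv.Perm (Fin n)} {A : Set (Fin n)}
    (hA : StrictMonoOn ⇑s⁻¹ A) {j j' : Fin n} (hj : (j : ℕ) + 1 = j') (h : s j' < s j) :
    StrictMonoOn ⇑(s * Equiv.swap j j')⁻¹ A := by
  intro a ha b hb hab
  simp only [mul_inv_rev, Equiv.swap_inv, Equiv.Perm.mul_apply]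
  refine swap_lt_swap hj (hA ha hb hab) ?_
  -- The swap reverses only the pair of values `j`, `j'`, and these occur at `s j > s j'`, so not in
  -- increasing order.
  rintro ⟨rfl, rfl⟩
  exact h.not_gt (by simpa using hab)

/-- If exactly one of `j`, `j'` were outside `Γ`, it would be fixed by `s` and the descent would
place it between two elements of `Γ`; if both were outside, there would be no descent. -/
lemma descentClosed_modifiedTransversal {n : ℕ} {Δ Γ : Set (Fin n)} (hΔ : Δ ⊆ Γ)
    (hΓ : Γ.OrdConnected) : DescentClosed (modifiedTransversal Δ Γ) := by
  intro s hs j j' hj h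
  rw [mem_modifiedTransversal_iff hΔ] at hs ⊢
  obtain ⟨hs, h1, h2⟩ := hs
  refine ⟨mul_mem hs (mem_symOn_iff.2 fun x hx => Equiv.swap_apply_of_ne_of_ne ?_ ?_),
    strictMonoOn_mul_swap_inv h1 hj h, strictMonoOn_mul_swap_inv h2 hj h⟩
  all_goals
    rintro rfl
    have hx' := mem_symOn_iff.1 hs x hx
  · have hj' : j' ∈ Γ := by
      by_contra hc
      rw [mem_symOn_iff.1 hs j' hc, hx', Fin.lt_def] at h
      omega
    refine hx (hΓ.out ((preserves_of_mem_symOn hs j').2 hj') hj' ⟨?_, ?_⟩)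
    · rw [← hx']; exact h.le
    · rw [Fin.le_def]; omega
  · have hj' : j ∈ Γ := by
      by_contra hc
      rw [mem_symOn_iff.1 hs j hc, hx', Fin.lt_def] at h
      omega
    refine hx (hΓ.out hj' ((preserves_of_mem_symOn hs j).2 hj') ⟨?_, ?_⟩)
    · rw [Fin.le_def]; omega
    · rw [← hx']; exact h.le

/-! ### Refining partitions -/

lemma partOf_eq {n : ℕ} {P : Set (Set (Fin n))} (hP : ∀ a, ∃! A, A ∈ P ∧ a ∈ A) {A : Set (Fin n)}
    {x : Fin n} (hA : A ∈ P) (hx : x ∈ A) : partOf P x = A := by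
  have : {B ∈ P | x ∈ B} = {A} := by
    ext B
    exact ⟨fun h => (hP x).unique h ⟨hA, hx⟩, by rintro rfl; exact ⟨hA, hx⟩⟩
  rw [partOf, this, Set.sUnion_singleton]

lemma partOf_mem {n : ℕ} {P : Set (Set (Fin n))} (hP : ∀ a, ∃! A, A ∈ P ∧ a ∈ A) (x : Fin n) :
    partOf P x ∈ P ∧ x ∈ partOf P x := by
  obtain ⟨A, ⟨hA, hx⟩, -⟩ := hP x
  rw [partOf_eq hP hA hx]
  exact ⟨hA, hx⟩

/-- A descent cannot straddle two parts: for intervals preserved by `s`, it would force `s j` into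
the part of `j'`. So the swap preserves each part. -/
lemma descentClosed_youngSet {n : ℕ} {P : Set (Set (Fin n))} (hP : ∀ a, ∃! A, A ∈ P ∧ a ∈ A)
    (hord : ∀ A ∈ P, A.OrdConnected) : DescentClosed (youngSet P) := by
  intro s hs j j' hj h
  rw [mem_youngSet_iff] at hs ⊢
  have hjj' : j ≤ j' := by rw [Fin.le_def]; omega
  have key : ∀ A ∈ P, j ∈ A → j' ∈ A := by
    intro A hA hjA
    by_contra hj'A
    obtain ⟨B, ⟨hB, hjB⟩, -⟩ := hP j'
    have hle : s j ≤ j' := by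
      by_contra hc
      exact hj'A ((hord A hA).out hjA ((hs A hA j).2 hjA) ⟨hjj', (not_le.1 hc).le⟩)
    have hsB : s j ∈ B := (hord B hB).out ((hs B hB j').2 hjB) hjB ⟨h.le, hle⟩
    rw [(hP j).unique ⟨hA, hjA⟩ ⟨hB, (hs B hB j).1 hsB⟩] at hj'A
    exact hj'A hjB
  have key' : ∀ A ∈ P, j' ∈ A → j ∈ A := by
    intro A hA hjA
    obtain ⟨B, ⟨hB, hjB⟩, -⟩ := hP j
    rwa [(hP j').unique ⟨hA, hjA⟩ ⟨hB, key B hB hjB⟩]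
  refine fun A hA => (hs A hA).mul fun x => ?_
  rw [Equiv.swap_apply_def]
  split_ifs with h1 h2
  · rw [h1]; exact ⟨key' A hA, key A hA⟩
  · rw [h2]; exact ⟨key A hA, key' A hA⟩
  · rfl

/-- The partition obtained from `P` by splitting the part `Γ` into `{x}`, `Δ ∖ {x}`, `Γ ∖ Δ`. -/
def splitPart {n : ℕ} (P : Set (Set (Fin n))) (Γ Δ : Set (Fin n)) (x : Fin n) :
    Set (Set (Fin n)) :=
  (P \ {Γ}) ∪ ({{x}, Δ \ {x}, Γ \ Δ} \ {∅})

lemma mem_splitPart_and_mem_iff {n : ℕ} {P : Set (Set (Fin n))} {Γ Δ : Set (Fin n)} {x : Fin n}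
    {B : Set (Fin n)} {a : Fin n} : B ∈ splitPart P Γ Δ x ∧ a ∈ B ↔
      (B ∈ P ∧ B ≠ Γ ∧ a ∈ B) ∨ (B = {x} ∧ a = x) ∨ (B = Δ \ {x} ∧ a ∈ Δ ∧ a ≠ x) ∨
        (B = Γ \ Δ ∧ a ∈ Γ ∧ a ∉ Δ) := by
  have hne : a ∈ B → B ≠ ∅ := fun h => Set.Nonempty.ne_empty ⟨a, h⟩
  simp only [splitPart, Set.mem_union, Set.mem_sdiff, Set.mem_insert_iff, Set.mem_singleton_iff]
  constructor
  · rintro ⟨h1 | ⟨rfl | rfl | rfl, -⟩, ha⟩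
    · exact Or.inl ⟨h1.1, h1.2, ha⟩
    · exact Or.inr (Or.inl ⟨rfl, ha⟩)
    · exact Or.inr (Or.inr (Or.inl ⟨rfl, ha.1, ha.2⟩))
    · exact Or.inr (Or.inr (Or.inr ⟨rfl, ha.1, ha.2⟩))
  · rintro (⟨h1, h2, ha⟩ | ⟨rfl, rfl⟩ | ⟨rfl, ha⟩ | ⟨rfl, ha⟩)
    · exact ⟨Or.inl ⟨h1, h2⟩, ha⟩
    · exact ⟨Or.inr ⟨Or.inl rfl, hne rfl⟩, rfl⟩
    · exact ⟨Or.inr ⟨Or.inr (Or.inl rfl), hne ha⟩, ha⟩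
    · exact ⟨Or.inr ⟨Or.inr (Or.inr rfl), hne ha⟩, ha⟩

lemma existsUnique_mem_splitPart {n : ℕ} {P : Set (Set (Fin n))} {Γ Δ : Set (Fin n)} {x : Fin n}
    (hP : ∀ a, ∃! A, A ∈ P ∧ a ∈ A) (hΓ : Γ ∈ P) (hΔ : Δ ⊆ Γ) (hx : x ∈ Δ) (a : Fin n) :
    ∃! A, A ∈ splitPart P Γ Δ x ∧ a ∈ A := by
  simp only [mem_splitPart_and_mem_iff]
  have hu : ∀ B ∈ P, a ∈ B → a ∈ Γ → B = Γ := fun B hB ha h =>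
    (hP a).unique ⟨hB, ha⟩ ⟨hΓ, h⟩
  by_cases haΓ : a ∈ Γ
  · by_cases haΔ : a ∈ Δ
    · by_cases hax : a = x
      · exact ⟨{x}, by tauto, fun B hB => by grind⟩
      · exact ⟨Δ \ {x}, by tauto, fun B hB => by grind⟩
    · exact ⟨Γ \ Δ, by tauto, fun B hB => by grind⟩
  · obtain ⟨A, ⟨hA, ha⟩, hAu⟩ := hP a
    exact ⟨A, Or.inl ⟨hA, fun h => haΓ (h ▸ ha), ha⟩, fun B hB => by grind⟩

lemma mem_youngSet_splitPart_iff {n : ℕ} {P : Set (Set (Fin n))} {Γ Δ : Set (Fin n)} {x : Fin n}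
    (hΓ : Γ ∈ P) (hΔ : Δ ⊆ Γ)
    {s : Equiv.Perm (Fin n)} :
    s ∈ youngSet (splitPart P Γ Δ x) ↔ s ∈ youngSet P ∧ Preserves s Δ ∧ s x = x := by
  simp only [mem_youngSet_iff]
  constructor
  · intro h
    have hex : ∀ B, (B ∈ ({{x}, Δ \ {x}, Γ \ Δ} : Set (Set (Fin n)))) → Preserves s B := by
      intro B hB
      by_cases hB0 : B = ∅
      · subst hB0
        exact fun _ => Iff.rfl
      · exact h B (Or.inr ⟨hB, hB0⟩)
    have h1 := hex {x} (by simp)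
    have h2 := hex (Δ \ {x}) (by simp)
    have h3 := hex (Γ \ Δ) (by simp)
    have hsx : s x = x := (h1 x).2 rfl
    have hsΔ : Preserves s Δ := fun y => by
      by_cases hy : y = x
      · rw [hy, hsx]
      · have := h2 y
        have h4 : s y ≠ x := fun h => hy ((h1 y).1 h)
        simpa [hy, h4] using this
    refine ⟨fun A hA => ?_, hsΔ, hsx⟩
    by_cases hAΓ : A = Γ
    · subst hAΓ
      intro y
      have h4 := h3 y
      have h5 := hsΔ y
      simp only [Set.mem_sdiff] at h4
      by_cases hy : y ∈ Δ
      · exact iff_of_true (hΔ (h5.2 hy)) (hΔ hy)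
      · have h6 : s y ∉ Δ := fun h => hy (h5.1 h)
        simpa [hy, h6] using h4
    · exact h A (Or.inl ⟨hA, hAΓ⟩)
  · rintro ⟨h, hsΔ, hsx⟩ A (⟨hA, -⟩ | ⟨hA, -⟩)
    · exact h A hA
    have hx1 : Preserves s {x} := fun y =>
      ⟨fun hy => s.injective (Eq.trans hy hsx.symm), fun hy => by rw [hy]; exact hsx⟩
    rcases hA with rfl | rfl | rfl
    · exact hx1
    · exact hsΔ.diff hx1
    · exact (h Γ hΓ).diff hsΔ

/-! ### The stabilizer chain -/

section Chain

variable {n k : ℕ} {G : Subgroup (Equiv.Perm (Fin n))} {b : Fin k → Fin n}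

lemma mem_stabChain_iff {i : ℕ} {g : Equiv.Perm (Fin n)} :
    g ∈ stabChain G b i ↔ g ∈ G ∧ ∀ j : Fin k, (j : ℕ) < i → g (b j) = b j := by
  simp [stabChain, Subgroup.mem_inf, Subgroup.mem_iInf, MulAction.mem_stabilizer_iff]

lemma stabChain_zero : stabChain G b 0 = G := by
  ext g
  simp [mem_stabChain_iff]

lemma mem_stabChain_succ_iff {i : ℕ} (hi : i < k) {g : Equiv.Perm (Fin n)} :
    g ∈ stabChain G b (i + 1) ↔ g ∈ stabChain G b i ∧ g (b ⟨i, hi⟩) = b ⟨i, hi⟩ := by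
  simp only [mem_stabChain_iff, and_assoc]
  refine and_congr_right fun _ => ⟨fun h => ⟨fun j hj => h j (by omega), h _ (by simp)⟩,
    fun h j hj => ?_⟩
  rcases Nat.lt_succ_iff_lt_or_eq.1 hj with hj | rfl
  · exact h.1 j hj
  · exact h.2

lemma mem_delta_iff {i : Fin k} {y : Fin n} :
    y ∈ delta G b i ↔ ∃ g ∈ stabChain G b i, g (b i) = y :=
  ⟨fun ⟨g, hg⟩ => ⟨g, g.2, hg⟩, fun ⟨g, hg, h⟩ => ⟨⟨g, hg⟩, h⟩⟩

lemma self_mem_delta (i : Fin k) : b i ∈ delta G b i := mem_delta_iff.2 ⟨1, one_mem _, rfl⟩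

lemma preserves_delta {i : Fin k} {g : Equiv.Perm (Fin n)} (hg : g ∈ stabChain G b i) :
    Preserves g (delta G b i) := by
  intro x
  simp only [mem_delta_iff]
  constructor
  · rintro ⟨h, hh, hx⟩
    exact ⟨g⁻¹ * h, mul_mem (inv_mem hg) hh, by simp [hx]⟩
  · rintro ⟨h, hh, rfl⟩
    exact ⟨g * h, mul_mem hg hh, rfl⟩

lemma parts_succ {i : ℕ} (hi : i < k) : parts G b (i + 1) =
    splitPart (parts G b i) (gamma G b ⟨i, hi⟩) (delta G b ⟨i, hi⟩) (b ⟨i, hi⟩) := by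
  rw [parts, dif_pos hi]
  rfl

lemma delta_subset_gamma_of {i : Fin k} (hP : ∀ a, ∃! A, A ∈ parts G b i ∧ a ∈ A)
    (hG : ∀ g ∈ stabChain G b i, g ∈ youngSet (parts G b i)) : delta G b i ⊆ gamma G b i := by
  intro y hy
  obtain ⟨g, hg, rfl⟩ := mem_delta_iff.1 hy
  have := partOf_mem hP (b i)
  exact (mem_youngSet_iff.1 (hG g hg) _ this.1 _).2 this.2

/-- The two claims need a joint induction: invariance of the parts under the stabilizer puts the
orbit inside `gamma`, without which the split need not be a partition. -/
lemma parts_invariant {i : ℕ} (hi : i ≤ k) : (∀ a, ∃! A, A ∈ parts G b i ∧ a ∈ A) ∧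
    ∀ g ∈ stabChain G b i, g ∈ youngSet (parts G b i) := by
  induction i with
  | zero =>
    refine ⟨fun a => ⟨Set.univ, ⟨rfl, trivial⟩, fun A hA => hA.1⟩, fun g _ => ?_⟩
    rw [mem_youngSet_iff]
    rintro A rfl x
    exact Iff.rfl
  | succ i ih =>
    obtain ⟨hP, hG⟩ := ih (by omega)
    have hΓ := (partOf_mem hP (b ⟨i, hi⟩)).1
    have hΔ := delta_subset_gamma_of (i := ⟨i, hi⟩) hP hG
    rw [parts_succ hi]
    refine ⟨existsUnique_mem_splitPart hP hΓ hΔ (self_mem_delta _), fun g hg => ?_⟩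
    rw [mem_stabChain_succ_iff hi] at hg
    exact (mem_youngSet_splitPart_iff hΓ hΔ).2
      ⟨hG g hg.1, preserves_delta (i := ⟨i, hi⟩) hg.1, hg.2⟩

lemma existsUnique_mem_parts {i : ℕ} (hi : i ≤ k) (a : Fin n) : ∃! A, A ∈ parts G b i ∧ a ∈ A :=
  (parts_invariant hi).1 a

lemma mem_youngSet_of_mem_stabChain {i : ℕ} (hi : i ≤ k) {g : Equiv.Perm (Fin n)}
    (hg : g ∈ stabChain G b i) : g ∈ youngSet (parts G b i) := (parts_invariant hi).2 g hg

lemma gamma_mem_parts (i : Fin k) : gamma G b i ∈ parts G b i :=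
  (partOf_mem (existsUnique_mem_parts i.2.le) (b i)).1

lemma delta_subset_gamma (i : Fin k) : delta G b i ⊆ gamma G b i :=
  delta_subset_gamma_of (existsUnique_mem_parts i.2.le)
    fun _ => mem_youngSet_of_mem_stabChain i.2.le

lemma mem_youngSet_parts_succ_iff (i : Fin k) {s : Equiv.Perm (Fin n)} :
    s ∈ youngSet (parts G b (i + 1)) ↔
      s ∈ youngSet (parts G b i) ∧ Preserves s (delta G b i) ∧ s (b i) = b i := by
  rw [parts_succ i.2]
  exact mem_youngSet_splitPart_iff (gamma_mem_parts i) (delta_subset_gamma i)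

lemma mem_youngSet_parts_of_mem_symOn_gamma (i : Fin k) {s : Equiv.Perm (Fin n)}
    (hs : s ∈ symOn (gamma G b i)) : s ∈ youngSet (parts G b i) := by
  rw [mem_youngSet_iff]
  intro A hA
  by_cases h : A = gamma G b i
  · rw [h]; exact preserves_of_mem_symOn hs
  · refine preserves_of_mem_symOn_of_disjoint hs (Set.disjoint_left.2 fun x hx hxA => h ?_)
    exact (existsUnique_mem_parts i.2.le x).unique ⟨hA, hxA⟩ ⟨gamma_mem_parts i, hx⟩

lemma mem_U_iff (i : Fin k) {u : Equiv.Perm (Fin n)} : u ∈ U G b i ↔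
    u ∈ symOn (gamma G b i) ∧ StrictMonoOn ⇑u⁻¹ (delta G b i) ∧
      StrictMonoOn ⇑u⁻¹ (gamma G b i \ delta G b i) :=
  mem_modifiedTransversal_iff (delta_subset_gamma i)

/-- The product `H_k U_k ⋯ U_{i+1}`, a right transversal of `G_i` in the Young subgroup of
the partition `Π_i`. -/
def tailTransversal (G : Subgroup (Equiv.Perm (Fin n))) (b : Fin k → Fin n) (i : ℕ) :
    Set (Equiv.Perm (Fin n)) :=
  youngSet (parts G b k) * ((List.ofFn (U G b)).drop i).reverse.prod

lemma tailTransversal_zero : tailTransversal G b 0 = dixonTransversal G b := rfl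

lemma tailTransversal_last : tailTransversal G b k = youngSet (parts G b k) := by
  rw [tailTransversal, List.drop_of_length_le (by simp), List.reverse_nil, List.prod_nil, mul_one]

lemma tailTransversal_eq_mul (i : Fin k) :
    tailTransversal G b i = tailTransversal G b (i + 1) * U G b i := by
  rw [tailTransversal, tailTransversal, List.drop_eq_getElem_cons (by simp), List.reverse_cons,
    List.prod_append, List.prod_singleton, List.getElem_ofFn, mul_assoc]

/-- Downward induction along the chain, from the last subgroup to the first. -/
lemma chain_induction {k : ℕ} {p : ℕ → Prop} (hk : p k) (hs : ∀ i : Fin k, p (i + 1) → p i) :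
    p 0 :=
  Nat.decreasingInduction (motive := fun i _ => p i) (fun i hi h => hs ⟨i, hi⟩ h) hk (Nat.zero_le k)

lemma tailTransversal_transversal (hB : IsOrbitMinimalBase G b) :
    tailTransversal G b 0 ⊆ youngSet (parts G b 0) ∧
    (∀ h ∈ youngSet (parts G b 0), ∃ g ∈ stabChain G b 0, ∃ r ∈ tailTransversal G b 0,
      h = g * r) ∧
    ∀ g ∈ stabChain G b 0, ∀ r ∈ tailTransversal G b 0, ∀ r' ∈ tailTransversal G b 0,
      g * r = r' → g = 1 := by
  refine chain_induction (k := k) (p := fun i => tailTransversal G b i ⊆ youngSet (parts G b i) ∧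
    (∀ h ∈ youngSet (parts G b i), ∃ g ∈ stabChain G b i, ∃ r ∈ tailTransversal G b i,
      h = g * r) ∧
    ∀ g ∈ stabChain G b i, ∀ r ∈ tailTransversal G b i, ∀ r' ∈ tailTransversal G b i,
      g * r = r' → g = 1) ?_ ?_
  · rw [tailTransversal_last, hB.1]
    exact ⟨subset_rfl, fun h hh => ⟨1, one_mem _, h, hh, (one_mul h).symm⟩,
      fun g hg _ _ _ _ _ => Subgroup.mem_bot.1 hg⟩
  · rintro i ⟨ih1, ih2, ih3⟩
    have hΔ := delta_subset_gamma (G := G) (b := b) i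
    have hΓ := gamma_mem_parts (G := G) (b := b) i
    rw [tailTransversal_eq_mul i]
    refine ⟨?_, ?_, ?_⟩
    · rintro _ ⟨r, hr, u, hu, rfl⟩
      exact mul_mem_youngSet ((mem_youngSet_parts_succ_iff i).1 (ih1 hr)).1
        (mem_youngSet_parts_of_mem_symOn_gamma i ((mem_U_iff i).1 hu).1)
    · intro h hh
      obtain ⟨l, u, hu, hlΔ, rfl⟩ :=
        exists_mul_mem_modifiedTransversal hΔ (mem_youngSet_iff.1 hh _ hΓ)
      have hl : l ∈ youngSet (parts G b i) := by
        have := mul_mem_youngSet hh (inv_mem_youngSet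
          (mem_youngSet_parts_of_mem_symOn_gamma i ((mem_U_iff i).1 hu).1))
        rwa [mul_inv_cancel_right] at this
      -- Transitivity on the orbit: `g` in the stabilizer sends `b i` where `l` does, so `g⁻¹ * l`
      -- fixes `b i` and drops to the next Young subgroup.
      obtain ⟨g, hg, hgl⟩ := mem_delta_iff.1 ((hlΔ (b i)).2 (self_mem_delta i))
      have hgl' : g⁻¹ * l ∈ youngSet (parts G b (i + 1)) :=
        (mem_youngSet_parts_succ_iff i).2
          ⟨mul_mem_youngSet (inv_mem_youngSet (mem_youngSet_of_mem_stabChain i.2.le hg)) hl,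
            (preserves_delta hg).inv.mul hlΔ, by simp [← hgl]⟩
      obtain ⟨g', hg', r, hr, hgr⟩ := ih2 _ hgl'
      refine ⟨g * g', mul_mem hg ((mem_stabChain_succ_iff i.2).1 hg').1, r * u,
        Set.mul_mem_mul hr hu, ?_⟩
      rw [inv_mul_eq_iff_eq_mul] at hgr
      rw [hgr]
      simp only [mul_assoc]
    · rintro g hg _ ⟨r, hr, u, hu, rfl⟩ _ ⟨r', hr', u', hu', rfl⟩ heq
      have heq : (g * r) * u = r' * u' := (mul_assoc _ _ _).trans heq
      have hr1 := (mem_youngSet_parts_succ_iff i).1 (ih1 hr)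
      have hr1' := (mem_youngSet_parts_succ_iff i).1 (ih1 hr')
      have hgY := mem_youngSet_of_mem_stabChain i.2.le hg
      have hu1 : u = u' := eq_of_mul_eq_mul_modifiedTransversal hΔ
        ((preserves_delta hg).mul hr1.2.1) (mem_youngSet_iff.1 (mul_mem_youngSet hgY hr1.1) _ hΓ)
        hr1'.2.1 (mem_youngSet_iff.1 hr1'.1 _ hΓ) hu hu' heq
      rw [hu1, mul_left_inj] at heq
      -- With `u` cancelled, `r` and `r'` both fix `b i`, hence so does `g`.
      refine ih3 g ((mem_stabChain_succ_iff i.2).2 ⟨hg, ?_⟩) r hr r' hr' heq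
      have := congrArg (fun s : Equiv.Perm (Fin n) => s (b i)) heq
      simpa [hr1.2.2, hr1'.2.2] using this

lemma tailTransversal_gallery (hN : ∀ i ≤ k, ∀ A ∈ parts G b i, A.OrdConnected) :
    1 ∈ tailTransversal G b 0 ∧
    ∀ r ∈ tailTransversal G b 0,
      Relation.ReflTransGen (GalleryStep (tailTransversal G b 0)) r 1 := by
  refine chain_induction (k := k) (p := fun i => 1 ∈ tailTransversal G b i ∧
    ∀ r ∈ tailTransversal G b i, Relation.ReflTransGen (GalleryStep (tailTransversal G b i)) r 1)
    ?_ ?_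
  · rw [tailTransversal_last]
    refine ⟨one_mem_youngSet _, fun r hr => ?_⟩
    have := (descentClosed_youngSet (existsUnique_mem_parts le_rfl) (hN k le_rfl)).reflTransGen
      (A := {1}) rfl r hr
    rwa [Set.singleton_one, one_mul, one_mul] at this
  · rintro i ⟨ih1, ih2⟩
    have hΔ := delta_subset_gamma (G := G) (b := b) i
    have h1 : 1 ∈ U G b i := one_mem_modifiedTransversal hΔ
    rw [tailTransversal_eq_mul i]
    exact ⟨⟨1, ih1, 1, h1, one_mul 1⟩, reflTransGen_mul
      (descentClosed_modifiedTransversal hΔ (hN i i.2.le _ (gamma_mem_parts i))) h1 ih2⟩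

end Chain

end PermFund

theorem mainTheorem2 (n k : ℕ) (G : Subgroup (Equiv.Perm (Fin n))) (b : Fin k → Fin n)
    (hB : PermFund.IsOrbitMinimalBase G b)
    (hN : ∀ i ≤ k, ∀ A ∈ PermFund.parts G b i, A.OrdConnected) :
    Subgroup.IsComplement (G : Set (Equiv.Perm (Fin n))) (PermFund.dixonTransversal G b) ∧
    PermFund.IsFundamentalDomain G
      (interior (⋃ r ∈ PermFund.dixonTransversal G b,
        closure (PermFund.chamber (PermFund.rho r)))) := by
  obtain ⟨-, hcov, huniq⟩ := PermFund.tailTransversal_transversal hB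
  obtain ⟨h1, hgal⟩ := PermFund.tailTransversal_gallery hN
  rw [PermFund.tailTransversal_zero] at hcov huniq h1 hgal
  rw [PermFund.stabChain_zero] at hcov huniq
  have hcov' : ∀ s, ∃ g ∈ G, ∃ r ∈ PermFund.dixonTransversal G b, s = g * r := fun s =>
    hcov s (PermFund.mem_youngSet_iff.2 (by rintro A rfl x; exact Iff.rfl))
  refine ⟨⟨?_, fun s => ?_⟩, ?_⟩
  · rintro ⟨⟨g, hg⟩, ⟨r, hr⟩⟩ ⟨⟨g', hg'⟩, ⟨r', hr'⟩⟩ h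
    have h : g * r = g' * r' := h
    have hgg : g'⁻¹ * g = 1 := huniq _ (mul_mem (inv_mem hg') hg) r hr r' hr' (by
      rw [mul_assoc, h, inv_mul_cancel_left])
    obtain rfl : g' = g := inv_mul_eq_one.1 hgg
    obtain rfl : r = r' := mul_left_cancel h
    rfl
  · obtain ⟨g, hg, r, hr, rfl⟩ := hcov' s
    exact ⟨⟨⟨g, hg⟩, ⟨r, hr⟩⟩, rfl⟩
  · simp only [PermFund.chamber_rho]
    exact PermFund.isFundamentalDomain_chamberDomain G hcov' huniq h1 hgal
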